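/- Let $X$ be a noetherian scheme, let $U \subseteq X$ be an open subset, and put $Y = X \setminus U$. If the inclusion $U \hookrightarrow X$ is an affine morphism, then every irreducible component $Z$ of $Y$ has codimension $\leq 1$ in $X$, i.e. every chain $Z = Z_0 \subsetneq Z_1 \subsetneq \dots \subsetneq Z_n$ of irreducible closed subsets of $X$ has length $n \leq 1$. In particular, if $X$ is separated and the open subscheme $U$ is itself affine, then every irreducible component of $Y$ has codimension $\leq 1$ in $X$. -/

import Mathlib

open AlgebraicGeometry TopologicalSpace

universe u

/-- The irreducible components of a subset `Y` of a topological space `T` (in the subspace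
topology), regarded as irreducible closed subsets of `T`. For closed `Y` every irreducible
component of `Y` is of this form, see `exists_mem_componentsIn`. -/
def componentsIn {T : Type*} [TopologicalSpace T] (Y : Set T) : Set (IrreducibleCloseds T) :=
  {Z | ∃ C ∈ irreducibleComponents Y, (Subtype.val '' C : Set T) = Z}

theorem exists_mem_componentsIn {T : Type*} [TopologicalSpace T] {Y : Set T} (hY : IsClosed Y)
    {C : Set Y} (hC : C ∈ irreducibleComponents Y) :
    ∃ Z ∈ componentsIn Y, (Z : Set T) = Subtype.val '' C :=
  ⟨⟨Subtype.val '' C, hC.1.image _ continuous_subtype_val.continuousOn,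
    hY.isClosedEmbedding_subtypeVal.isClosedMap _ (isClosed_of_mem_irreducibleComponents C hC)⟩,
    ⟨C, hC, rfl⟩, rfl⟩

/-- The codimension of an irreducible closed subset `Z` of `T`: the supremum of the lengths `n` of
chains `Z = Z₀ ⊂ Z₁ ⊂ ⋯ ⊂ Zₙ` of irreducible closed subsets of `T`. -/
noncomputable def codimension {T : Type*} [TopologicalSpace T] (Z : IrreducibleCloseds T) : ℕ∞ :=
  Order.coheight Z

/-! Localize at the generic point of Z: the trace of U is the punctured spectrum of a noetherian
local ring, and its inclusion is still affine. If the codimension exceeded 1, some quotient of this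
ring would be a two-dimensional local domain S with affine punctured spectrum V
(`eq_maximalIdeal_of_isAffineHom`). Choose x, y in S with V = D(x) ∪ D(y). As V is affine, bx + cy =
1 for sections b, c on V, and powers of x and of y carry b, c into S. Expanding powers of this
identity gives, for some fixed m and all k, (xy)^(mk) ∈ (x^((m+1)k), y^((m+1)k))
(`exists_forall_mul_pow_mem_span_pair`). Hence l(k) = length S/(x^k, y^k) satisfies l((m+1)k) ≤
m(m+2) l(k), which is slower than quadratic growth since m(m+2) < (m+1)². But l grows at least
quadratically in dimension two (`exists_sq_le_length_quotient_pow`). -/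

section Length

/-! ### Lengths of quotients by monomial ideals -/

variable {S : Type*} [CommRing S]

theorem length_quotient_anti {J K : Ideal S} (h : J ≤ K) :
    Module.length S (S ⧸ K) ≤ Module.length S (S ⧸ J) :=
  Module.length_le_of_surjective (Submodule.factor h) (Submodule.factor_surjective h)

/-- Length is additive along `0 → S ⧸ (J : a) → S ⧸ J → S ⧸ (J + (a)) → 0`. -/
theorem length_quotient_eq_add (J : Ideal S) (a : S) :
    Module.length S (S ⧸ J) =
      Module.length S (S ⧸ Submodule.comap (LinearMap.mulLeft S a) J) +
        Module.length S (S ⧸ (J ⊔ Ideal.span {a})) := by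
  refine Module.length_eq_add_of_exact
    (Submodule.mapQ (Submodule.comap (LinearMap.mulLeft S a) J) J (LinearMap.mulLeft S a) le_rfl)
    (Submodule.factor le_sup_left) ?_ (Submodule.factor_surjective _) ?_
  · rw [← LinearMap.ker_eq_bot, Submodule.ker_mapQ, Submodule.mkQ_map_self]
  · intro r
    obtain ⟨r, rfl⟩ := Submodule.Quotient.mk_surjective _ r
    constructor
    · intro h
      have h' : r ∈ J ⊔ Ideal.span {a} := by
        rwa [← Submodule.mkQ_apply, Submodule.factor_mk, Submodule.mkQ_apply,
          Submodule.Quotient.mk_eq_zero] at h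
      obtain ⟨j, hj, t, ht, rfl⟩ := Submodule.mem_sup.1 h'
      obtain ⟨t, rfl⟩ := Ideal.mem_span_singleton'.1 ht
      refine ⟨Submodule.Quotient.mk t, ?_⟩
      rw [Submodule.mapQ_apply, Submodule.Quotient.eq]
      simp only [LinearMap.mulLeft_apply]
      convert J.neg_mem hj using 1
      ring
    · rintro ⟨t, ht⟩
      obtain ⟨t, rfl⟩ := Submodule.Quotient.mk_surjective _ t
      rw [← ht, Submodule.mapQ_apply, ← Submodule.mkQ_apply, Submodule.factor_mk,
        Submodule.mkQ_apply, Submodule.Quotient.mk_eq_zero]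
      exact Submodule.mem_sup_right
        (Ideal.mul_mem_right _ _ (Ideal.mem_span_singleton_self a))

theorem length_quotient_le_add {J K K' : Ideal S} (a : S) (hK : K ≤ J ⊔ Ideal.span {a})
    (hK' : ∀ r ∈ K', a * r ∈ J) :
    Module.length S (S ⧸ J) ≤ Module.length S (S ⧸ K') + Module.length S (S ⧸ K) := by
  rw [length_quotient_eq_add J a]
  exact add_le_add (length_quotient_anti hK') (length_quotient_anti hK)

theorem add_one_le_length_quotient {J K : Ideal S} (h : J < K) :
    Module.length S (S ⧸ K) + 1 ≤ Module.length S (S ⧸ J) := by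
  obtain ⟨a, haK, haJ⟩ := SetLike.exists_of_lt h
  rw [length_quotient_eq_add J a, add_comm]
  refine add_le_add ?_ (length_quotient_anti (sup_le h.le ?_))
  · rw [Order.one_le_iff_pos, Module.length_pos_iff, Submodule.Quotient.nontrivial_iff]
    intro h1
    have : (1 : S) ∈ (Submodule.comap (LinearMap.mulLeft S a) J) := h1 ▸ Submodule.mem_top
    simp at this
    exact haJ this
  · rwa [Ideal.span_singleton_le_iff_mem]

theorem mul_mem_of_mem_span_pair {a x y : S} {J : Ideal S} (hx : a * x ∈ J) (hy : a * y ∈ J) :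
    ∀ r ∈ Ideal.span {x, y}, a * r ∈ J := by
  intro r hr
  obtain ⟨u, v, rfl⟩ := Ideal.mem_span_pair.1 hr
  have : a * (u * x + v * y) = u * (a * x) + v * (a * y) := by ring
  rw [this]
  exact J.add_mem (J.mul_mem_left _ hx) (J.mul_mem_left _ hy)

theorem span_pair_le_iff {x y : S} {J : Ideal S} :
    Ideal.span {x, y} ≤ J ↔ x ∈ J ∧ y ∈ J := by
  rw [Ideal.span_le, Set.insert_subset_iff, Set.singleton_subset_iff]; rfl

theorem length_span_pow_right_le (x y : S) (n : ℕ) :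
    Module.length S (S ⧸ Ideal.span {x, y ^ n}) ≤
      n * Module.length S (S ⧸ Ideal.span {x, y}) := by
  induction n with
  | zero =>
    have : Subsingleton (S ⧸ Ideal.span {x, y ^ 0}) := by
      rw [Ideal.Quotient.subsingleton_iff, Ideal.eq_top_iff_one]
      exact Ideal.subset_span (by simp)
    simp [Module.length_eq_zero]
  | succ n ih =>
    rw [Nat.cast_succ, add_mul, one_mul]
    refine (length_quotient_le_add (K := Ideal.span {x, y}) (K' := Ideal.span {x, y ^ n}) y ?_
      (mul_mem_of_mem_span_pair ?_ ?_)).trans (add_le_add ih le_rfl)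
    · rw [span_pair_le_iff]
      exact ⟨Submodule.mem_sup_left (Ideal.subset_span (by simp)),
        Submodule.mem_sup_right (Ideal.subset_span (by simp))⟩
    · exact Ideal.mul_mem_left _ _ (Ideal.subset_span (by simp))
    · rw [← pow_succ']
      exact Ideal.subset_span (by simp)

theorem length_span_pow_pow_le (x y : S) (m n : ℕ) :
    Module.length S (S ⧸ Ideal.span {x ^ m, y ^ n}) ≤
      m * n * Module.length S (S ⧸ Ideal.span {x, y}) := by
  refine (length_span_pow_right_le _ _ _).trans ?_
  have := length_span_pow_right_le y x m
  rw [Set.pair_comm (x ^ m) y, Set.pair_comm x y]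
  calc _ ≤ (n : ℕ∞) * (m * Module.length S (S ⧸ Ideal.span {y, x})) := by gcongr
    _ = _ := by ring

/-- If the top monomial `(xy) ^ m` lies in `(x ^ (m + 1), y ^ (m + 1))`, then the monomial bound for
the length of the quotient by the latter ideal can be improved by one. -/
theorem length_span_pow_le_of_mul_pow_mem {x y : S} {m : ℕ}
    (h : (x * y) ^ m ∈ Ideal.span {x ^ (m + 1), y ^ (m + 1)}) :
    Module.length S (S ⧸ Ideal.span {x ^ (m + 1), y ^ (m + 1)}) ≤
      (m * (m + 2) : ℕ) * Module.length S (S ⧸ Ideal.span {x, y}) := by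
  -- The hypothesis puts y^m, not just y^(m+1), in the colon ideal by x^m; the count is m + m(m+1) =
  -- m(m+2).
  refine (length_quotient_le_add (K := Ideal.span {x ^ m, y ^ (m + 1)})
    (K' := Ideal.span {x, y ^ m}) (x ^ m) ?_ (mul_mem_of_mem_span_pair ?_ ?_)).trans ?_
  · rw [span_pair_le_iff]
    exact ⟨Submodule.mem_sup_right (Ideal.subset_span (by simp)),
      Submodule.mem_sup_left (Ideal.subset_span (by simp))⟩
  · rw [← pow_succ]
    exact Ideal.subset_span (by simp)
  · rwa [← mul_pow]
  · refine (add_le_add (length_span_pow_right_le _ _ _) (length_span_pow_pow_le _ _ _ _)).trans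
      (le_of_eq ?_)
    push_cast
    ring

/-- Artin–Rees puts xr in I^n·(x); then x cancels in the domain. -/
theorem exists_forall_mem_pow_of_mul_mem_pow [IsNoetherianRing S] [IsDomain S] (I : Ideal S)
    {x : S} (hx : x ≠ 0) :
    ∃ c, ∀ n r, x * r ∈ I ^ (n + c) → r ∈ I ^ n := by
  obtain ⟨c, hc⟩ := Ideal.exists_pow_inf_eq_pow_smul I (Ideal.span {x})
  refine ⟨c, fun n r hr ↦ ?_⟩
  have h := hc (n + c) (Nat.le_add_left _ _)
  have hmem : x * r ∈ (I ^ (n + c) • ⊤ ⊓ Ideal.span {x} : Ideal S) :=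
    ⟨by simpa using hr, Ideal.mul_mem_right _ _ (Ideal.mem_span_singleton_self x)⟩
  rw [h, Nat.add_sub_cancel] at hmem
  have : x * r ∈ I ^ n * Ideal.span {x} := Ideal.mul_mono_right inf_le_right hmem
  obtain ⟨t, ht, e⟩ := Ideal.mem_mul_span_singleton.1 this
  rw [mul_comm] at e
  rwa [← mul_left_cancel₀ hx e]

end Length

/-! ### Quadratic growth of lengths -/

section Growth

variable {S : Type*} [CommRing S] [IsLocalRing S]

open IsLocalRing

/-- The lengths increase strictly: stationarity would give 𝔪^n ⊆ (x) ⊆ p by Nakayama, hence p = 𝔪.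
-/
theorem le_length_quotient_pow_sup [IsNoetherianRing S] {x : S} {p : Ideal S} [p.IsPrime]
    (hxp : x ∈ p) (hp : p ≠ maximalIdeal S) (n : ℕ) :
    (n : ℕ∞) ≤ Module.length S (S ⧸ (maximalIdeal S ^ n ⊔ Ideal.span {x})) := by
  induction n with
  | zero => simp
  | succ n ih =>
    rw [Nat.cast_succ]
    refine (add_le_add ih le_rfl).trans (add_one_le_length_quotient ?_)
    refine lt_of_le_of_ne (sup_le_sup_right (Ideal.pow_le_pow_right n.le_succ) _) fun h ↦ hp ?_
    have hle : maximalIdeal S ^ n ≤ Ideal.span {x} := by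
      refine Submodule.le_of_le_smul_of_le_jacobson_bot (I := maximalIdeal S)
        (IsNoetherian.noetherian _) (IsLocalRing.jacobson_eq_maximalIdeal _ bot_ne_top).ge ?_
      rw [smul_eq_mul, ← pow_succ', sup_comm, h]
      exact le_sup_left
    have hmp : maximalIdeal S ≤ p :=
      Ideal.IsPrime.le_of_pow_le (hle.trans ((Ideal.span_singleton_le_iff_mem _).2 hxp))
    exact le_antisymm (le_maximalIdeal (Ideal.IsPrime.ne_top ‹_›)) hmp

/-- Quadratic growth of the Hilbert-Samuel function of a local domain which has a prime strictly
between zero and the maximal ideal. -/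
theorem exists_sq_le_length_quotient_pow [IsNoetherianRing S] [IsDomain S] {x : S} (hx : x ≠ 0)
    {p : Ideal S} [p.IsPrime] (hxp : x ∈ p) (hp : p ≠ maximalIdeal S) :
    ∃ c, 0 < c ∧ ∀ n : ℕ, (n ^ 2 : ℕ∞) ≤
      2 * Module.length S (S ⧸ maximalIdeal S ^ (c * n)) := by
  obtain ⟨c, hc⟩ := exists_forall_mem_pow_of_mul_mem_pow (maximalIdeal S) hx
  refine ⟨c + 1, c.succ_pos, fun n ↦ ?_⟩
  induction n with
  | zero => simp
  | succ n ih =>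
    -- The colon term dominates the previous length by Artin–Rees; the other term is at least n + 1.
    rw [length_quotient_eq_add _ x, mul_add]
    have h₁ : Module.length S (S ⧸ maximalIdeal S ^ ((c + 1) * n)) ≤ Module.length S
        (S ⧸ (Submodule.comap (LinearMap.mulLeft S x) (maximalIdeal S ^ ((c + 1) * (n + 1))))) := by
      refine length_quotient_anti fun r hr ↦ hc _ _ ?_
      exact Ideal.pow_le_pow_right (n := (c + 1) * (n + 1)) (by lia) hr
    have h₂ : ((n + 1 : ℕ) : ℕ∞) ≤ _ :=
      le_trans (Nat.cast_le.2 (by nlinarith))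
        (le_length_quotient_pow_sup hxp hp ((c + 1) * (n + 1)))
    calc (((n + 1 : ℕ) : ℕ∞) ^ 2) ≤ (n ^ 2 : ℕ∞) + 2 * (n + 1 : ℕ) := by
          norm_cast; nlinarith
      _ ≤ _ := add_le_add (ih.trans (mul_le_mul_right h₁ 2)) (mul_le_mul_right h₂ 2)

theorem length_span_pair_ne_top [IsNoetherianRing S] {x y : S}
    (h : ∀ P : Ideal S, P.IsPrime → x ∈ P → y ∈ P → P = maximalIdeal S) (k : ℕ) :
    Module.length S (S ⧸ Ideal.span {x ^ k, y ^ k}) ≠ ⊤ := by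
  set I := Ideal.span {x ^ k, y ^ k}
  have : Ring.KrullDimLE 0 (S ⧸ I) := by
    refine Ring.KrullDimLE.mk₀ fun P hP ↦ ?_
    have hmem : ∀ z : S, z ^ k ∈ I → z ∈ P.comap (Ideal.Quotient.mk I) := fun z hz ↦ by
      refine (hP.comap (Ideal.Quotient.mk I)).mem_of_pow_mem k ?_
      rw [Ideal.mem_comap, Ideal.Quotient.eq_zero_iff_mem.2 hz]
      exact P.zero_mem
    have hm := h _ (hP.comap (Ideal.Quotient.mk I)) (hmem x (Ideal.subset_span (by simp)))
      (hmem y (Ideal.subset_span (by simp)))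
    have : (P.comap (Ideal.Quotient.mk I)).IsMaximal := hm ▸ inferInstance
    rw [← Ideal.map_comap_of_surjective _ Ideal.Quotient.mk_surjective P]
    refine (Ideal.map_eq_top_or_isMaximal_of_surjective _ Ideal.Quotient.mk_surjective
      this).resolve_left ?_
    rw [Ideal.map_comap_of_surjective _ Ideal.Quotient.mk_surjective P]
    exact hP.ne_top
  have : IsArtinianRing (S ⧸ I) := IsNoetherianRing.isArtinianRing_of_krullDimLE_zero
  rw [Module.length_eq_of_surjective (R := S ⧸ I) (M := S ⧸ I) (S := S) Ideal.Quotient.mk_surjective]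
  exact Module.length_ne_top

/-- Quadratic growth of the length of `S ⧸ (x ^ k, y ^ k)` forbids uniform relations of the form
`(xy) ^ (mk) ∈ (x ^ ((m + 1) k), y ^ ((m + 1) k))`. -/
theorem not_forall_mul_pow_mem_span_pair [IsNoetherianRing S] [IsDomain S] {x y : S}
    (hx : x ≠ 0) (h : ∀ P : Ideal S, P.IsPrime → x ∈ P → y ∈ P → P = maximalIdeal S)
    (hxm : x ∈ maximalIdeal S) (hym : y ∈ maximalIdeal S)
    {p : Ideal S} [p.IsPrime] (hxp : x ∈ p) (hp : p ≠ maximalIdeal S) (m : ℕ) :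
    ∃ k, (x * y) ^ (m * k) ∉ Ideal.span {x ^ ((m + 1) * k), y ^ ((m + 1) * k)} := by
  by_contra! hk
  obtain ⟨c, hc, hlow⟩ := exists_sq_le_length_quotient_pow hx hxp hp
  set l : ℕ → ℕ∞ := fun k ↦ Module.length S (S ⧸ Ideal.span {x ^ k, y ^ k})
  have hstep (k : ℕ) : l ((m + 1) * k) ≤ (m * (m + 2) : ℕ) * l k := by
    have := length_span_pow_le_of_mul_pow_mem (x := x ^ k) (y := y ^ k) (m := m)
    rw [← mul_pow, ← pow_mul, ← pow_mul, ← pow_mul, mul_comm k m, mul_comm k (m + 1)] at this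
    exact this (hk k)
  -- Sampling at c(m+1)^j matches the multiples of c in the lower bound.
  have hup (j : ℕ) : l (c * (m + 1) ^ j) ≤ ((m * (m + 2)) ^ j : ℕ) * l c := by
    induction j with
    | zero => simp
    | succ j ih =>
      calc l (c * (m + 1) ^ (j + 1)) = l ((m + 1) * (c * (m + 1) ^ j)) := by congr 1; ring
        _ ≤ (m * (m + 2) : ℕ) * (((m * (m + 2)) ^ j : ℕ) * l c) :=
          (hstep _).trans (mul_le_mul_right ih _)
        _ = _ := by push_cast; ring
  obtain ⟨L, hL⟩ := ENat.ne_top_iff_exists.1 (length_span_pair_ne_top h c)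
  have hbound (j : ℕ) : ((m + 1) ^ j) ^ 2 ≤ 2 * ((m * (m + 2)) ^ j * L) := by
    have h₁ : Module.length S (S ⧸ maximalIdeal S ^ (c * (m + 1) ^ j)) ≤ l (c * (m + 1) ^ j) :=
      length_quotient_anti (span_pair_le_iff.2 ⟨Ideal.pow_mem_pow hxm _, Ideal.pow_mem_pow hym _⟩)
    have h₂ := (hlow ((m + 1) ^ j)).trans (mul_le_mul_right (h₁.trans (hup j)) 2)
    simp only [l, ← hL] at h₂
    exact_mod_cast h₂
  -- For m = 0 the ratio q would divide by zero; there `hbound 1` already reads 1 ≤ 0.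
  rcases Nat.eq_zero_or_pos m with rfl | hm
  · simpa using hbound 1
  set q : ℝ := (m + 1) ^ 2 / (m * (m + 2))
  have hm' : (0 : ℝ) < m := by exact_mod_cast hm
  have hq : 1 < q := by
    rw [one_lt_div (by positivity)]
    nlinarith
  obtain ⟨j, hj⟩ := pow_unbounded_of_one_lt (2 * L : ℝ) hq
  have hj' : (((m : ℝ) + 1) ^ j) ^ 2 ≤ 2 * ((m * (m + 2)) ^ j * L) := by exact_mod_cast hbound j
  rw [div_pow, lt_div_iff₀ (by positivity), ← pow_mul, mul_comm 2 j, pow_mul] at hj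
  linarith

end Growth

/-! ### Monomial relations from a partition of unity -/

section Relations

variable {S B : Type*} [CommRing S] [CommRing B] [Algebra S B]

/-- If `x` and `y` generate the unit ideal of `B`, and every element of `B` becomes an element of `S`
after multiplication by a power of `x`, and likewise for `y`, then the powers of `x` and `y` satisfy
uniform monomial relations in `S`. -/
theorem exists_forall_mul_pow_mem_span_pair (hinj : Function.Injective (algebraMap S B)) {x y : S}
    (hx : ∀ b : B, ∃ n : ℕ, ∃ r, algebraMap S B r = algebraMap S B x ^ n * b)
    (hy : ∀ b : B, ∃ n : ℕ, ∃ r, algebraMap S B r = algebraMap S B y ^ n * b)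
    (h : Ideal.span {algebraMap S B x, algebraMap S B y} = ⊤) :
    ∃ m : ℕ, ∀ k : ℕ,
      (x * y) ^ (m * k) ∈ Ideal.span {x ^ ((m + 1) * k), y ^ ((m + 1) * k)} := by
  obtain ⟨b, c, hbc⟩ := Ideal.mem_span_pair.1 ((Ideal.eq_top_iff_one _).1 h)
  have hmono {z : S} {d : B} {n n' : ℕ} (hn : n ≤ n')
      (hd : ∃ r, algebraMap S B r = algebraMap S B z ^ n * d) :
      ∃ r, algebraMap S B r = algebraMap S B z ^ n' * d := by
    obtain ⟨r, hr⟩ := hd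
    refine ⟨z ^ (n' - n) * r, ?_⟩
    rw [map_mul, hr, map_pow, ← mul_assoc, ← pow_add, Nat.sub_add_cancel hn]
  obtain ⟨s, hxb, hxc, hyb, hyc⟩ : ∃ s : ℕ,
      (∃ r, algebraMap S B r = algebraMap S B x ^ s * b) ∧
      (∃ r, algebraMap S B r = algebraMap S B x ^ s * c) ∧
      (∃ r, algebraMap S B r = algebraMap S B y ^ s * b) ∧
      (∃ r, algebraMap S B r = algebraMap S B y ^ s * c) := by
    obtain ⟨n₁, h₁⟩ := hx b
    obtain ⟨n₂, h₂⟩ := hx c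
    obtain ⟨n₃, h₃⟩ := hy b
    obtain ⟨n₄, h₄⟩ := hy c
    exact ⟨n₁ + n₂ + n₃ + n₄, hmono (by lia) h₁, hmono (by lia) h₂, hmono (by lia) h₃,
      hmono (by lia) h₄⟩
  obtain ⟨xb, hxb⟩ := hxb
  obtain ⟨xc, hxc⟩ := hxc
  obtain ⟨yb, hyb⟩ := hyb
  obtain ⟨yc, hyc⟩ := hyc
  -- In each term of (bx + cy)^(2k), the exponent i of bx or j of cy is at least k. If i ≥ k, then
  -- x^(2sk)·x^i is divisible by x^((2s+1)k), while y^(2sk) = y^(si)·y^(sj) clears b^i c^j;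
  -- symmetrically otherwise.
  refine ⟨2 * s, fun k ↦ ?_⟩
  set I := Ideal.span {x ^ ((2 * s + 1) * k), y ^ ((2 * s + 1) * k)}
  suffices algebraMap S B ((x * y) ^ (2 * s * k)) ∈
      (Submodule.map (Algebra.linearMap S B) I) by
    obtain ⟨r, hr, e⟩ := this
    rwa [← hinj e]
  have hone : (b * algebraMap S B x + c * algebraMap S B y) ^ (2 * k) = 1 := by rw [hbc, one_pow]
  rw [← mul_one (algebraMap S B _), ← hone, add_pow, Finset.mul_sum]
  refine Submodule.sum_mem _ fun i hi ↦ ?_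
  obtain ⟨j, hj⟩ := Nat.exists_eq_add_of_le (Nat.lt_succ_iff.1 (Finset.mem_range.1 hi))
  rw [hj, Nat.add_sub_cancel_left]
  have hexp : 2 * s * k = s * i + s * j := by rw [← mul_add, ← hj]; ring
  rcases le_total k i with hki | hki
  · obtain ⟨d, rfl⟩ := Nat.exists_eq_add_of_le hki
    refine ⟨x ^ ((2 * s + 1) * k) *
      (x ^ d * y ^ j * yb ^ (k + d) * yc ^ j * ((k + d + j).choose (k + d) : S)),
      Ideal.mul_mem_right _ _ (Ideal.subset_span (by simp)), ?_⟩
    simp only [Algebra.linearMap_apply, map_mul, map_pow, map_natCast, hyb, hyc]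
    rw [mul_pow (algebraMap S B x), add_mul (2 * s) 1 k, one_mul, hexp]
    ring
  · have hkj : k ≤ j := by lia
    obtain ⟨d, rfl⟩ := Nat.exists_eq_add_of_le hkj
    refine ⟨y ^ ((2 * s + 1) * k) *
      (y ^ d * x ^ i * xb ^ i * xc ^ (k + d) * ((i + (k + d)).choose i : S)),
      Ideal.mul_mem_right _ _ (Ideal.subset_span (by simp)), ?_⟩
    simp only [Algebra.linearMap_apply, map_mul, map_pow, map_natCast, hxb, hxc]
    rw [mul_pow (algebraMap S B x), add_mul (2 * s) 1 k, one_mul, hexp]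
    ring

end Relations

/-! ### Affine punctured spectra -/

section PuncturedSpectrum

open IsLocalRing CategoryTheory

theorem basicOpen_algebraMap_Spec (S : CommRingCat.{u}) (V : (Spec S).Opens) (x : S) :
    (Spec S).basicOpen (algebraMap S Γ(Spec S, V) x) = V ⊓ PrimeSpectrum.basicOpen x := by
  rw [IsAffineOpen.algebraMap_Spec_obj, CommRingCat.comp_apply, Scheme.basicOpen_res, basicOpen_eq_of_affine']
  simp

theorem res_algebraMap_Spec (S : CommRingCat.{u}) {V W : (Spec S).Opens} (i : W ⟶ V) (r : S) :
    (Spec S).presheaf.map i.op (algebraMap S Γ(Spec S, V) r) = algebraMap S Γ(Spec S, W) r := by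
  simp only [IsAffineOpen.algebraMap_Spec_obj, ← CommRingCat.comp_apply, Category.assoc, ← Functor.map_comp]
  rfl

/-- A section over an open subset of `Spec S` containing `D(x)` extends to `Spec S` after
multiplication by a power of `x`. -/
theorem exists_algebraMap_eq_pow_mul (S : CommRingCat.{u}) {V : (Spec S).Opens}
    (hV : IsAffineOpen V) {x : S} (hx : PrimeSpectrum.basicOpen x ≤ V) (b : Γ(Spec S, V)) :
    ∃ n : ℕ, ∃ r : S, algebraMap S Γ(Spec S, V) r = algebraMap S Γ(Spec S, V) x ^ n * b := by
  let D : (Spec S).Opens := PrimeSpectrum.basicOpen x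
  have : IsLocalization.Away x Γ(Spec S, D) := inferInstance
  let i : D ⟶ V := homOfLE hx
  let ρ := ((Spec S).presheaf.map i.op).hom
  have hloc := hV.isLocalization_of_eq_basicOpen (algebraMap S Γ(Spec S, V) x) i
    ((basicOpen_algebraMap_Spec S V x).trans (inf_eq_right.2 hx)).symm
  obtain ⟨⟨r, _, n, rfl⟩, hr⟩ := IsLocalization.surj (Submonoid.powers x) (S := Γ(Spec S, D)) (ρ b)
  let := ρ.toAlgebra
  have hr' : ρ (algebraMap S Γ(Spec S, V) x ^ n * b) = ρ (algebraMap S Γ(Spec S, V) r) := by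
    rw [map_mul, map_pow]
    change ((Spec S).presheaf.map i.op _) ^ n * _ = (Spec S).presheaf.map i.op _
    rw [res_algebraMap_Spec, res_algebraMap_Spec, ← hr, map_pow, mul_comm]
  -- Since V is affine, sections that agree on D(x) agree on V after multiplication by a power of x.
  obtain ⟨⟨_, k, rfl⟩, hk⟩ :=
    (IsLocalization.eq_iff_exists (Submonoid.powers (algebraMap S Γ(Spec S, V) x))
      Γ(Spec S, D)).1 hr'
  refine ⟨k + n, x ^ k * r, ?_⟩
  rw [map_mul, map_pow, pow_add, mul_assoc]
  exact hk.symm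

theorem algebraMap_Spec_injective (S : CommRingCat.{u}) [IsDomain S] {V : (Spec S).Opens}
    {x : S} (hx0 : x ≠ 0) (hx : PrimeSpectrum.basicOpen x ≤ V) :
    Function.Injective (algebraMap S Γ(Spec S, V)) := by
  let D : (Spec S).Opens := PrimeSpectrum.basicOpen x
  have : IsLocalization.Away x Γ(Spec S, D) := inferInstance
  let i : D ⟶ V := homOfLE hx
  have hinj : Function.Injective (algebraMap S Γ(Spec S, D)) :=
    IsLocalization.injective _ (M := Submonoid.powers x)
      (powers_le_nonZeroDivisors_of_noZeroDivisors hx0)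
  intro a b hab
  apply hinj
  rw [← res_algebraMap_Spec S i, ← res_algebraMap_Spec S i, hab]

/-- Prime avoidance yields y outside every non-maximal minimal prime of (x); a prime containing x
and y then lies strictly above such a prime, or above 𝔪. -/
theorem exists_forall_isPrime_eq_maximalIdeal {S : Type*} [CommRing S] [IsLocalRing S]
    [IsNoetherianRing S] [IsDomain S]
    (hS : ∀ P Q : Ideal S, P.IsPrime → Q.IsPrime → P ≠ ⊥ → P < Q → Q = maximalIdeal S)
    {x : S} (hx : x ≠ 0) :
    ∃ y ∈ maximalIdeal S, ∀ P : Ideal S, P.IsPrime → x ∈ P → y ∈ P → P = maximalIdeal S := by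
  let s : Set (Ideal S) := (Ideal.span {x}).minimalPrimes \ {maximalIdeal S}
  have hs : s.Finite := (Ideal.finite_minimalPrimes_of_isNoetherianRing S _).sdiff
  obtain ⟨y, hym, hy⟩ : ∃ y ∈ maximalIdeal S, ∀ P ∈ s, y ∉ P := by
    by_contra! h
    obtain ⟨P, hP, hle⟩ := (Ideal.subset_union_prime_finite hs (f := id) ⊥ ⊥
      (fun P hP _ _ ↦ hP.1.1.1) (I := maximalIdeal S)).1 fun y hy ↦ by simpa using h y hy
    exact hP.2 (le_antisymm (le_maximalIdeal hP.1.1.1.ne_top) hle)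
  refine ⟨y, hym, fun P hP hxP hyP ↦ ?_⟩
  obtain ⟨Q, hQ, hQP⟩ := Ideal.exists_minimalPrimes_le
    ((Ideal.span_singleton_le_iff_mem P).2 hxP)
  have hxQ : x ∈ Q := hQ.1.2 (Ideal.mem_span_singleton_self x)
  by_cases hQm : Q = maximalIdeal S
  · exact le_antisymm (le_maximalIdeal hP.ne_top) (hQm ▸ hQP)
  · refine hS Q P hQ.1.1 hP (fun h0 ↦ hx (by simpa [h0] using hxQ)) (lt_of_le_of_ne hQP ?_)
    rintro rfl
    exact hy Q ⟨hQ, hQm⟩ hyP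

/-- The punctured spectrum of a two-dimensional noetherian local domain is not affine. -/
theorem not_isAffineOpen_of_mem_iff_ne_closedPoint (S : CommRingCat.{u}) [IsLocalRing S]
    [IsNoetherianRing S] [IsDomain S]
    (hS : ∀ P Q : Ideal S, P.IsPrime → Q.IsPrime → P ≠ ⊥ → P < Q → Q = maximalIdeal S)
    {p : Ideal S} [p.IsPrime] (hp0 : p ≠ ⊥) (hp : p ≠ maximalIdeal S)
    {V : (Spec S).Opens} (hV : ∀ P : PrimeSpectrum S, P ∈ V ↔ P ≠ closedPoint S) :
    ¬ IsAffineOpen V := by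
  intro hVaff
  obtain ⟨x, hxp, hx⟩ := p.exists_mem_ne_zero_of_ne_bot hp0
  have hxm : x ∈ maximalIdeal S := le_maximalIdeal (Ideal.IsPrime.ne_top ‹_›) hxp
  obtain ⟨y, hym, hxy⟩ := exists_forall_isPrime_eq_maximalIdeal hS hx
  have hle {z : S} (hz : z ∈ maximalIdeal S) : PrimeSpectrum.basicOpen z ≤ V := by
    intro P hP
    refine (hV P).2 ?_
    rintro rfl
    exact hP hz
  have hspan : Ideal.span {algebraMap S Γ(Spec S, V) x, algebraMap S Γ(Spec S, V) y} = ⊤ := by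
    rw [← hVaff.self_le_iSup_basicOpen_iff]
    intro P hP
    rw [Opens.mem_iSup]
    by_cases hxP : x ∈ P.asIdeal
    · have hyP : y ∉ P.asIdeal := fun hyP ↦
        (hV P).1 hP (PrimeSpectrum.ext (hxy P.asIdeal P.isPrime hxP hyP))
      refine ⟨⟨_, Set.mem_insert_of_mem _ rfl⟩, ?_⟩
      rw [basicOpen_algebraMap_Spec]
      exact ⟨hP, hyP⟩
    · refine ⟨⟨_, Set.mem_insert _ _⟩, ?_⟩
      rw [basicOpen_algebraMap_Spec]
      exact ⟨hP, hxP⟩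
  obtain ⟨m, hm⟩ := exists_forall_mul_pow_mem_span_pair
    (algebraMap_Spec_injective S hx (hle hxm))
    (exists_algebraMap_eq_pow_mul S hVaff (hle hxm))
    (exists_algebraMap_eq_pow_mul S hVaff (hle hym)) hspan
  obtain ⟨k, hk⟩ := not_forall_mul_pow_mem_span_pair hx hxy hxm hym hxp hp m
  exact hk (hm k)

/-- A noetherian local ring with affine punctured spectrum has dimension at most one: an affine
punctured spectrum passes to quotients, so it suffices to treat a quotient of dimension two. -/
theorem eq_maximalIdeal_of_isAffineHom (R : CommRingCat.{u}) [IsLocalRing R]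
    [IsNoetherianRing R] {V : (Spec R).Opens}
    (hV : ∀ P : PrimeSpectrum R, P ∈ V ↔ P ≠ closedPoint R) [IsAffineHom V.ι]
    {P₀ P₁ : Ideal R} (hP₀ : P₀.IsPrime) (hP₁ : P₁.IsPrime) (h : P₀ < P₁) : P₁ = maximalIdeal R := by
  by_contra hne
  -- Maximality of q excludes longer chains, so R/q has dimension exactly two.
  obtain ⟨q, ⟨hq, p, hp, hqp, hpm⟩, hmax⟩ := set_has_maximal_iff_noetherian.2
    (inferInstanceAs (_root_.IsNoetherian R R))
    {q : Ideal R | q.IsPrime ∧ ∃ p : Ideal R, p.IsPrime ∧ q < p ∧ p ≠ maximalIdeal R}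
    ⟨P₀, hP₀, P₁, hP₁, h, hne⟩
  let S : CommRingCat.{u} := .of (R ⧸ q)
  let π : R →+* S := Ideal.Quotient.mk q
  have hπ : Function.Surjective π := Ideal.Quotient.mk_surjective
  have : IsDomain S := inferInstanceAs (IsDomain (R ⧸ q))
  have : IsNoetherianRing S := inferInstanceAs (IsNoetherianRing (R ⧸ q))
  have : IsLocalRing S := .of_surjective' π hπ
  have hlocal : IsLocalHom π := hπ.isLocalHom
  have hker : RingHom.ker π = q := Ideal.mk_ker
  have hcomap : (maximalIdeal S).comap π = maximalIdeal R := ((local_hom_TFAE π).out 0 4).1 hlocal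
  have hinj : Function.Injective (Ideal.comap π) := Ideal.comap_injective_of_surjective π hπ
  let f : Spec S ⟶ Spec R := Spec.map (CommRingCat.ofHom π)
  have hpmap : (p.map π).comap π = p := by
    rw [Ideal.comap_map_of_surjective _ hπ, ← RingHom.ker_eq_comap_bot, hker, sup_eq_left]
    exact hqp.le
  have : (p.map π).IsPrime := Ideal.map_isPrime_of_surjective hπ (hker.trans_le hqp.le)
  have hfV : IsAffineOpen (f ⁻¹ᵁ V) := IsAffine.of_isPullback (isPullback_morphismRestrict f V).flip
  refine not_isAffineOpen_of_mem_iff_ne_closedPoint S ?_ (p := p.map π) ?_ ?_ ?_ hfV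
  · intro P Q hP hQ hP0 hPQ
    by_contra hQm
    refine hmax (P.comap π) ⟨hP.comap π, Q.comap π, hQ.comap π, ?_, ?_⟩ ?_
    · exact lt_of_le_of_ne (Ideal.comap_mono hPQ.le) (hinj.ne hPQ.ne)
    · rw [← hcomap]
      exact hinj.ne hQm
    · refine (hker.symm.trans (RingHom.ker_eq_comap_bot π)).trans_lt ?_
      exact lt_of_le_of_ne (Ideal.comap_mono bot_le) (hinj.ne hP0.symm)
  · intro h0
    rw [h0, ← RingHom.ker_eq_comap_bot, hker] at hpmap
    exact hqp.ne hpmap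
  · intro h0
    rw [h0, hcomap] at hpmap
    exact hpm hpmap.symm
  · intro P
    refine (hV (PrimeSpectrum.comap π P)).trans (not_congr ⟨fun h ↦ ?_, ?_⟩)
    · refine PrimeSpectrum.ext (hinj ?_)
      exact (congrArg PrimeSpectrum.asIdeal h).trans hcomap.symm
    · rintro rfl
      exact PrimeSpectrum.ext hcomap

end PuncturedSpectrum

/-! ### Passage from the scheme to the local ring -/

section Codimension

open CategoryTheory

theorem eq_of_mem_componentsIn {T : Type*} [TopologicalSpace T] {Y : Set T}
    {Z : IrreducibleCloseds T} (hZ : Z ∈ componentsIn Y) {W : Set T} (hW : IsIrreducible W)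
    (hWY : W ⊆ Y) (hZW : (Z : Set T) ⊆ W) : (Z : Set T) = W := by
  obtain ⟨C, hC, hCZ⟩ := hZ
  have hle : C ≤ Subtype.val ⁻¹' W := fun c hc ↦ hZW (hCZ ▸ ⟨c, hc, rfl⟩)
  have himage : Subtype.val '' (Subtype.val ⁻¹' W : Set Y) = W := by
    rw [Subtype.image_preimage_coe, Set.inter_eq_right.2 hWY]
  have hirr : IsIrreducible (Subtype.val ⁻¹' W : Set Y) := by
    obtain ⟨w, hw⟩ := hW.nonempty
    refine ⟨⟨⟨w, hWY hw⟩, hw⟩, ?_⟩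
    rintro _ _ ⟨u, hu, rfl⟩ ⟨v, hv, rfl⟩ ⟨a, ha, hau⟩ ⟨b, hb, hbv⟩
    obtain ⟨d, hd, hduv⟩ := hW.isPreirreducible u v hu hv ⟨a, ha, hau⟩ ⟨b, hb, hbv⟩
    exact ⟨⟨d, hWY hd⟩, hd, hduv⟩
  rw [← hCZ, ← himage, hC.eq_of_le hirr hle]

theorem subset_of_mem_componentsIn {T : Type*} [TopologicalSpace T] {Y : Set T}
    {Z : IrreducibleCloseds T} (hZ : Z ∈ componentsIn Y) : (Z : Set T) ⊆ Y := by
  obtain ⟨C, -, hCZ⟩ := hZ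
  rw [← hCZ]
  exact Subtype.coe_image_subset _ _

theorem codimension_le_one_of_isAffineHom (X : Scheme.{u}) [IsLocallyNoetherian X] (U : X.Opens)
    [IsAffineHom U.ι] {Z : IrreducibleCloseds X} (hZ : Z ∈ componentsIn ((U : Set X)ᶜ)) :
    codimension Z ≤ 1 := by
  by_contra! hcodim
  obtain ⟨c, hc0, hcl⟩ := Order.exists_series_of_le_coheight Z (n := 2)
    (by exact Order.add_one_le_of_lt hcodim)
  obtain ⟨Z₁, Z₂, h₁, h₂⟩ : ∃ Z₁ Z₂, Z < Z₁ ∧ Z₁ < Z₂ :=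
    ⟨c ⟨1, by lia⟩, c ⟨2, by lia⟩,
      hc0.symm.trans_lt (c.strictMono (a := 0) (Fin.mk_lt_mk.2 one_pos)),
      c.strictMono (Fin.mk_lt_mk.2 one_lt_two)⟩
  have hgen (W : IrreducibleCloseds X) : ∃ w : X, IsGenericPoint w (W : Set X) :=
    QuasiSober.sober W.isIrreducible W.isClosed
  obtain ⟨z, hz⟩ := hgen Z
  obtain ⟨z₁, hz₁⟩ := hgen Z₁
  obtain ⟨z₂, hz₂⟩ := hgen Z₂
  let g := X.fromSpecStalk z
  have hg : Topology.IsEmbedding g := g.isEmbedding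
  have hgz : g (IsLocalRing.closedPoint _) = z := Scheme.fromSpecStalk_closedPoint
  have hlift {w : X} (hw : w ⤳ z) : ∃ P, g P = w := by
    have : w ∈ Set.range g := by rwa [Scheme.range_fromSpecStalk]
    exact this
  obtain ⟨P₁, hP₁⟩ := hlift (hz₁.specializes (h₁.le hz.mem))
  obtain ⟨P₂, hP₂⟩ := hlift (hz₂.specializes (h₂.le (h₁.le hz.mem)))
  have hspec : P₂ ⤳ P₁ := by
    rw [← hg.isInducing.specializes_iff, hP₁, hP₂]
    exact hz₂.specializes (h₂.le hz₁.mem)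
  have hlt : P₂.asIdeal < P₁.asIdeal := by
    refine lt_of_le_of_ne ((PrimeSpectrum.le_iff_specializes P₂ P₁).2 hspec) fun h ↦ h₂.ne ?_
    have : z₁ = z₂ := by rw [← hP₁, ← hP₂, PrimeSpectrum.ext h]
    exact SetLike.coe_injective (by rw [← hz₁.def, ← hz₂.def, this])
  have hmem (P : PrimeSpectrum (X.presheaf.stalk z)) :
      P ∈ g ⁻¹ᵁ U ↔ P ≠ IsLocalRing.closedPoint _ := by
    constructor
    · rintro hP rfl
      have hzU : z ∈ U := hgz ▸ hP
      exact subset_of_mem_componentsIn hZ hz.mem hzU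
    · intro hP
      by_contra hPU
      refine hP (hg.injective ?_)
      have hPz : g P ⤳ z := by
        have : g P ∈ Set.range g := ⟨P, rfl⟩
        rwa [Scheme.range_fromSpecStalk] at this
      -- A generization of z outside U has its closure in Y and containing Z, so maximality of the
      -- component makes it z.
      have heq := eq_of_mem_componentsIn hZ (W := closure {g P}) isIrreducible_singleton.closure
        (closure_minimal (Set.singleton_subset_iff.2 hPU) U.isOpen.isClosed_compl) (by
          rw [← hz.def]
          exact hPz.closure_subset)
      rw [hgz]
      exact IsGenericPoint.eq heq.symm hz
  have : IsAffineHom (g ⁻¹ᵁ U).ι :=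
    MorphismProperty.of_isPullback (isPullback_morphismRestrict g U) ‹IsAffineHom U.ι›
  have hP₁m := eq_maximalIdeal_of_isAffineHom (X.presheaf.stalk z) hmem P₂.isPrime P₁.isPrime hlt
  have hzz : z = z₁ :=
    (hgz.symm.trans (congrArg g (PrimeSpectrum.ext hP₁m.symm))).trans hP₁
  exact h₁.ne (SetLike.coe_injective (by rw [← hz.def, ← hz₁.def, hzz]))

/-- In a separated scheme the intersection of two affine opens is affine. -/
theorem isAffineHom_ι_of_isAffineOpen (X : Scheme.{u}) [X.IsSeparated] {U : X.Opens}
    (hU : IsAffineOpen U) : IsAffineHom U.ι where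
  isAffine_preimage W hW := by
    rw [← U.ι.isAffineOpen_iff_of_isOpenImmersion, Scheme.Hom.image_preimage_eq_opensRange_inf,
      Scheme.Opens.opensRange_ι]
    exact hU.inf hW

end Codimension

theorem mainTheorem2 (X : Scheme.{u}) [AlgebraicGeometry.IsNoetherian X] (U : X.Opens) :
    (IsAffineHom U.ι → ∀ Z ∈ componentsIn ((U : Set X)ᶜ), codimension Z ≤ 1) ∧
    (X.IsSeparated → IsAffineOpen U →
      ∀ Z ∈ componentsIn ((U : Set X)ᶜ), codimension Z ≤ 1) :=
  ⟨fun _ _ hZ ↦ codimension_le_one_of_isAffineHom X U hZ, fun _ hU _ hZ ↦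
    have := isAffineHom_ι_of_isAffineOpen X hU
    codimension_le_one_of_isAffineHom X U hZ⟩
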